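/- Consider the nonlinear Woinowsky-Krieger equation for a hinged beam, $$u_{tt}+u_{xxxx}-\frac{2}{\pi}\,\|u_x\|^2_{L^2(0,\pi)}\,u_{xx}=0\quad (0<x<\pi),\qquad u(0,t)=u(\pi,t)=u_{xx}(0,t)=u_{xx}(\pi,t)=0 .$$ For an integer $m\ge 1$, a function $\Theta_m:\mathbb R\to\mathbb R$ is called an $m$-th nonlinear mode if $u(x,t)=\Theta_m(t)\sin(mx)$ is a classical solution of this problem for all $t\in\mathbb R$; equivalently, $\Theta_m$ solves $\ddot\Theta_m+m^4\Theta_m+m^4\Theta_m^3=0$. For an integer $n\ge1$, $n\ne m$, the mode $\Theta_m$ is called linearly stable with respect to the $n$-th mode $\Theta_n$ if the solution $\xi\equiv0$ of the linear Hill equation $$\ddot\xi(t)+\bigl(n^4+m^2n^2\,\Theta_m(t)^2\bigr)\xi(t)=0\qquad(t\in\mathbb R)$$ is stable in the sense of Lyapunov on $\mathbb R$, that is, for all $t_0\in\mathbb R$ and $\varepsilon>0$ there is $\rho>0$ such that every solution $\xi$ with $|\xi(t_0)|<\rho$ and $|\dot\xi(t_0)|<\rho$ satisfies $|\xi(t)|<\varepsilon$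 and $|\dot\xi(t)|<\varepsilon$ for all $t\in\mathbb R$. **Theorem.** Let $m>n\ge1$ be integers and let $\delta\in\mathbb R$, $\delta\neq0$. If $\Theta_m$ is the $m$-th nonlinear mode with $\Theta_m(0)=\delta$ and $\dot\Theta_m(0)=0$, then $\Theta_m$ is linearly stable with respect to $\Theta_n$. -/

import Mathlib

/-- `u` (with arguments the position `x` and the time `t`) is a classical solution of the nonlinear
Woinowsky-Krieger equation for a beam hinged at both endpoints of `[0, π]`:
`u_tt + u_xxxx - (2/π) ‖u_x‖²_{L²(0,π)} u_xx = 0` in `(0, π)`, and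
`u = u_xx = 0` at `x = 0` and at `x = π`, for all times. -/
structure IsBeamSolution (u : ℝ → ℝ → ℝ) : Prop where
  contDiff_time : ∀ x ∈ Set.Icc 0 Real.pi, ContDiff ℝ 2 (fun t => u x t)
  contDiff_space : ∀ t, ContDiffOn ℝ 4 (fun x => u x t) (Set.Icc 0 Real.pi)
  equation : ∀ x ∈ Set.Ioo 0 Real.pi, ∀ t,
    iteratedDeriv 2 (fun s => u x s) t
      + iteratedDerivWithin 4 (fun y => u y t) (Set.Icc 0 Real.pi) x
      - 2 / Real.pi
        * (∫ y in (0 : ℝ)..Real.pi, (derivWithin (fun z => u z t) (Set.Icc 0 Real.pi) y) ^ 2)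
        * iteratedDerivWithin 2 (fun y => u y t) (Set.Icc 0 Real.pi) x = 0
  boundary_left : ∀ t, u 0 t = 0
  boundary_right : ∀ t, u Real.pi t = 0
  boundary_left_xx : ∀ t, iteratedDerivWithin 2 (fun y => u y t) (Set.Icc 0 Real.pi) 0 = 0
  boundary_right_xx : ∀ t, iteratedDerivWithin 2 (fun y => u y t) (Set.Icc 0 Real.pi) Real.pi = 0

/-- `Θ` is (the time profile of) an `m`-th nonlinear mode: `u(x, t) = Θ(t) sin (m x)` solves the
beam equation. -/
def IsNonlinearMode (m : ℕ) (Θ : ℝ → ℝ) : Prop :=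
  IsBeamSolution (fun x t => Θ t * Real.sin (m * x))

/-- `ξ` solves the linear equation `ξ'' + p ξ = 0` on the whole real line. -/
def IsHillSolution (p ξ : ℝ → ℝ) : Prop :=
  Differentiable ℝ ξ ∧ Differentiable ℝ (deriv ξ) ∧ ∀ t, deriv (deriv ξ) t + p t * ξ t = 0

/-- Lyapunov stability of the trivial solution of `ξ'' + p ξ = 0`: solutions with small data
`(ξ, ξ')` at some time `t₀` stay small, together with their derivative, on the whole real line. -/
def TrivialSolutionStable (p : ℝ → ℝ) : Prop :=
  ∀ t₀ : ℝ, ∀ ε > 0, ∃ ρ > 0, ∀ ξ : ℝ → ℝ, IsHillSolution p ξ →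
    |ξ t₀| < ρ → |deriv ξ t₀| < ρ → ∀ t, |ξ t| < ε ∧ |deriv ξ t| < ε

/-- The `m`-th mode `Θ` is linearly stable with respect to the `n`-th mode: the trivial solution of
`ξ'' + (n⁴ + m² n² Θ(t)²) ξ = 0` is stable. -/
def LinearlyStable (m n : ℕ) (Θ : ℝ → ℝ) : Prop :=
  TrivialSolutionStable (fun t => (n : ℝ) ^ 4 + (m : ℝ) ^ 2 * (n : ℝ) ^ 2 * Θ t ^ 2)

/-!
Measure time from the first positive zero `a` of the mode `Θ`, taken with `Θ 0 > 0`, and put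
`V t = Θ (a - t)`. Both the mode and the perturbation solve a Hill equation: `V'' + Q V = 0` with
`Q = m⁴ + m⁴ V²`, and `ξ'' + P ξ = 0` with `P = n⁴ + m² n² V²`, so that `0 < P < Q` as `n < m`.
Uniqueness for Duffing's equation makes `V` odd about `0` and even about `a`; hence `P` is even and
`2 a`-periodic, and it increases with `V` on the quarter period `[0, a]`.

Stability comes from two comparisons with `V` on `[0, a]`. A solution `D` with `D 0 = 0`,
`D' 0 > 0` has `D, D' > 0` at `a` by Sturm's theorem (`QuarterPeriod.deriv_pos_of_dirichlet`). A
solution `S` with `S' 0 = 0`, `S 0 > 0` has `S > 0 > S'` at `a`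
(`QuarterPeriod.pos_of_neumann`): here `V` is compared with the reversed solution `S (b - t)`, whose
coefficient `P (b - t)` need not lie below `Q`, and the monotonicity of `P` makes up for that.
Consequently odd solutions satisfy `α D a = β D' a` and even ones `α' S a = -β' S' a` with fixed
positive constants. Multiplying the two relations for the odd and the even part of an arbitrary
solution `ξ` shows that the positive definite form `α α' ξ² + β β' ξ'²` takes the same value at `-a`
and `a` (`QuarterPeriod.exists_invariant_form`), hence at all times `(2 k + 1) a`, and Grönwall's
inequality bounds `ξ` in between (`QuarterPeriod.stable`). This replaces the trace criterion of
Floquet theory and needs no existence theorem for Hill's equation.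
-/

open Set

/-! ### Solutions of Hill's equation -/

namespace IsHillSolution

variable {p q ξ η : ℝ → ℝ}

lemma hasDerivAt (h : IsHillSolution p ξ) (t : ℝ) : HasDerivAt ξ (deriv ξ t) t :=
  (h.1 t).hasDerivAt

lemma hasDerivAt_deriv (h : IsHillSolution p ξ) (t : ℝ) :
    HasDerivAt (deriv ξ) (-(p t * ξ t)) t := by
  have h1 := (h.2.1 t).hasDerivAt
  have h2 := h.2.2 t
  rwa [show deriv (deriv ξ) t = -(p t * ξ t) by linarith] at h1

lemma of_hasDerivAt {ξ' : ℝ → ℝ} (h1 : ∀ t, HasDerivAt ξ (ξ' t) t)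
    (h2 : ∀ t, HasDerivAt ξ' (-(p t * ξ t)) t) : IsHillSolution p ξ := by
  have h : deriv ξ = ξ' := funext fun t => (h1 t).deriv
  refine ⟨fun t => (h1 t).differentiableAt, ?_, fun t => ?_⟩
  · rw [h]
    exact fun t => (h2 t).differentiableAt
  · rw [h, (h2 t).deriv]
    ring

lemma add (h : IsHillSolution p ξ) (k : IsHillSolution p η) :
    IsHillSolution p (fun t => ξ t + η t) :=
  of_hasDerivAt (fun t => (h.hasDerivAt t).add (k.hasDerivAt t)) fun t =>
    ((h.hasDerivAt_deriv t).add (k.hasDerivAt_deriv t)).congr_deriv (by ring)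

lemma neg (h : IsHillSolution p ξ) : IsHillSolution p (fun t => -ξ t) :=
  of_hasDerivAt (fun t => (h.hasDerivAt t).neg) fun t =>
    ((h.hasDerivAt_deriv t).neg).congr_deriv (by ring)

lemma hasDerivAt_const_sub (h : IsHillSolution p ξ) (c t : ℝ) :
    HasDerivAt (fun t => ξ (c - t)) (-deriv ξ (c - t)) t :=
  (h.hasDerivAt (c - t)).comp_const_sub c t

lemma deriv_const_sub (h : IsHillSolution p ξ) (c t : ℝ) :
    deriv (fun t => ξ (c - t)) t = -deriv ξ (c - t) :=
  (h.hasDerivAt_const_sub c t).deriv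

lemma const_sub (h : IsHillSolution p ξ) (c : ℝ) :
    IsHillSolution (fun t => p (c - t)) (fun t => ξ (c - t)) :=
  of_hasDerivAt (h.hasDerivAt_const_sub c) fun t =>
    ((h.hasDerivAt_deriv (c - t)).comp_const_sub c t).neg.congr_deriv (by ring)

lemma add_const (h : IsHillSolution p ξ) (c : ℝ) :
    IsHillSolution (fun t => p (t + c)) (fun t => ξ (t + c)) :=
  of_hasDerivAt (fun t => (h.hasDerivAt (t + c)).comp_add_const t c)
    fun t => (h.hasDerivAt_deriv (t + c)).comp_add_const t c

/-- The derivative of the Wronskian of solutions of two different Hill equations. -/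
lemma hasDerivAt_wronskian (h : IsHillSolution p ξ) (k : IsHillSolution q η) (t : ℝ) :
    HasDerivAt (fun t => ξ t * deriv η t - deriv ξ t * η t) ((p t - q t) * (ξ t * η t)) t :=
  (((h.hasDerivAt t).mul (k.hasDerivAt_deriv t)).sub
    ((h.hasDerivAt_deriv t).mul (k.hasDerivAt t))).congr_deriv (by ring)

lemma wronskian_eq (h : IsHillSolution p ξ) (k : IsHillSolution p η) (s t : ℝ) :
    ξ s * deriv η s - deriv ξ s * η s = ξ t * deriv η t - deriv ξ t * η t :=
  is_const_of_deriv_eq_zero (fun r => (h.hasDerivAt_wronskian k r).differentiableAt)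
    (fun r => by rw [(h.hasDerivAt_wronskian k r).deriv]; ring) s t

/-! ### Growth and uniqueness -/

/-- The Grönwall bound forward in time. -/
lemma energy_le (h : IsHillSolution p ξ) {K s t : ℝ} (hst : s ≤ t)
    (hK : ∀ r ∈ Icc s t, |p r| ≤ K) :
    ξ t ^ 2 + deriv ξ t ^ 2 ≤ (ξ s ^ 2 + deriv ξ s ^ 2) * Real.exp ((1 + K) * (t - s)) := by
  have hd : ∀ r, HasDerivAt
      (fun r => (ξ r ^ 2 + deriv ξ r ^ 2) * Real.exp ((1 + K) * (t - r)))
      ((2 * (1 - p r) * (ξ r * deriv ξ r) - (1 + K) * (ξ r ^ 2 + deriv ξ r ^ 2))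
        * Real.exp ((1 + K) * (t - r))) r := fun r => by
    have h1 := (((h.hasDerivAt r).pow 2).add ((h.hasDerivAt_deriv r).pow 2)).mul
      (((hasDerivAt_id r).const_sub t).const_mul (1 + K)).exp
    refine h1.congr_deriv ?_
    simp only [Pi.add_apply, Pi.pow_apply, id]
    push_cast
    ring
  have hanti : AntitoneOn (fun r => (ξ r ^ 2 + deriv ξ r ^ 2) * Real.exp ((1 + K) * (t - r)))
      (Icc s t) := by
    refine antitoneOn_of_deriv_nonpos (convex_Icc s t)
      (fun r _ => (hd r).continuousAt.continuousWithinAt)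
      (fun r _ => (hd r).differentiableAt.differentiableWithinAt) fun r hr => ?_
    rw [(hd r).deriv]
    rw [interior_Icc] at hr
    obtain ⟨h1, h2⟩ := abs_le.1 (hK r (Ioo_subset_Icc_self hr))
    refine mul_nonpos_of_nonpos_of_nonneg ?_ (Real.exp_pos _).le
    have h3 : 0 ≤ (1 + K + (1 - p r)) * (ξ r - deriv ξ r) ^ 2 :=
      mul_nonneg (by linarith) (sq_nonneg _)
    have h4 : 0 ≤ (1 + K - (1 - p r)) * (ξ r + deriv ξ r) ^ 2 :=
      mul_nonneg (by linarith) (sq_nonneg _)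
    linarith
  simpa using hanti (left_mem_Icc.2 hst) (right_mem_Icc.2 hst) hst

/-- The Grönwall bound in both directions of time. -/
lemma energy_le_abs (h : IsHillSolution p ξ) {K s t : ℝ} (hK : ∀ r ∈ uIcc s t, |p r| ≤ K) :
    ξ t ^ 2 + deriv ξ t ^ 2 ≤ (ξ s ^ 2 + deriv ξ s ^ 2) * Real.exp ((1 + K) * |t - s|) := by
  rcases le_total s t with hst | hst
  · rw [abs_of_nonneg (sub_nonneg.2 hst)]
    exact h.energy_le hst fun r hr => hK r (by rwa [uIcc_of_le hst])
  · have h1 := (h.const_sub 0).energy_le (K := K) (neg_le_neg hst) fun r hr =>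
      hK (0 - r) (by
        rw [uIcc_of_ge hst]
        exact ⟨by linarith [hr.2], by linarith [hr.1]⟩)
    rw [h.deriv_const_sub, h.deriv_const_sub] at h1
    rw [abs_of_nonpos (sub_nonpos.2 hst)]
    simpa [neg_add_eq_sub] using h1

lemma eq_zero (h : IsHillSolution p ξ) (hp : Continuous p) (h0 : ξ 0 = 0)
    (h1 : deriv ξ 0 = 0) : ξ = 0 := by
  funext t
  obtain ⟨K, hK⟩ := (isCompact_uIcc (a := (0 : ℝ)) (b := t)).exists_bound_of_continuousOn
    hp.continuousOn
  have h2 := h.energy_le_abs hK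
  rw [h0, h1] at h2
  rw [Pi.zero_apply]
  nlinarith [sq_nonneg (ξ t), sq_nonneg (deriv ξ t)]

end IsHillSolution

/-! ### Positivity of even and odd solutions -/

lemma exists_first_zero {f : ℝ → ℝ} (hf : Continuous f) {a c : ℝ} (h0 : 0 < f 0)
    (hc : c ∈ Icc 0 a) (hfc : f c ≤ 0) :
    ∃ b ∈ Ioc 0 a, f b = 0 ∧ ∀ t ∈ Ico 0 b, 0 < f t := by
  obtain ⟨b, ⟨hb, hfb⟩, hmin⟩ := (isCompact_Icc.inter_right
    (isClosed_le hf continuous_const)).exists_isLeast (⟨c, hc, hfc⟩ :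
      (Icc 0 a ∩ {t | f t ≤ 0}).Nonempty)
  have hpos : ∀ t ∈ Ico 0 b, 0 < f t := fun t ht => by
    by_contra hcon
    exact (hmin ⟨⟨ht.1, ht.2.le.trans hb.2⟩, not_lt.1 hcon⟩).not_gt ht.2
  have hb0 : 0 < b := hb.1.lt_of_ne fun hb0 => by
    rw [← hb0] at hfb
    exact hfb.not_gt h0
  refine ⟨b, ⟨hb0, hb.2⟩, le_antisymm hfb ?_, hpos⟩
  -- `f` is positive to the left of `b`
  refine ge_of_tendsto (hf.continuousAt.tendsto.mono_left nhdsWithin_le_nhds :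
    Filter.Tendsto f (nhdsWithin b (Iio b)) (nhds (f b))) ?_
  filter_upwards [Ico_mem_nhdsLT hb0] with t ht using (hpos t ht).le

/-- The situation on a quarter period `[0, a]` of the mode, time being measured from a zero of the
mode: `V` solves the Hill equation with coefficient `Q` and increases from `V 0 = 0`, and `P` is a
positive nondecreasing coefficient below `Q`. -/
structure QuarterPeriod (P Q V : ℝ → ℝ) (a : ℝ) : Prop where
  pos : 0 < a
  sol : IsHillSolution Q V
  zero : V 0 = 0
  pos_of_mem : ∀ t ∈ Ioc 0 a, 0 < V t
  deriv_nonneg : ∀ t ∈ Icc 0 a, 0 ≤ deriv V t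
  coeff_continuous : Continuous P
  coeff_pos : ∀ t ∈ Icc 0 a, 0 < P t
  coeff_mono : MonotoneOn P (Icc 0 a)
  coeff_lt : ∀ t ∈ Icc 0 a, P t < Q t

namespace QuarterPeriod

variable {P Q V : ℝ → ℝ} {a : ℝ}

/-- Sturm comparison with `V`: a solution starting at `0` with positive slope is still increasing
at the end of the quarter period. -/
lemma deriv_pos_of_dirichlet (H : QuarterPeriod P Q V a) {D : ℝ → ℝ} (hD : IsHillSolution P D)
    (h0 : D 0 = 0) (h1 : 0 < deriv D 0) : ∀ t ∈ Icc 0 a, 0 < deriv D t := by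
  intro c hc
  by_contra hcon
  obtain ⟨b, hb, hb0, hpos⟩ := exists_first_zero hD.2.1.continuous h1 hc (not_lt.1 hcon)
  have hmono : StrictMonoOn D (Icc 0 b) := strictMonoOn_of_deriv_pos (convex_Icc 0 b)
    hD.1.continuous.continuousOn fun t ht => by
      rw [interior_Icc] at ht
      exact hpos t ⟨ht.1.le, ht.2⟩
  have hDpos : ∀ t ∈ Ioc 0 b, 0 < D t := fun t ht =>
    h0 ▸ hmono (left_mem_Icc.2 hb.1.le) ⟨ht.1.le, ht.2⟩ ht.1
  have hW : StrictMonoOn (fun t => V t * deriv D t - deriv V t * D t) (Icc 0 b) :=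
    strictMonoOn_of_deriv_pos (convex_Icc 0 b)
      (fun t _ => (H.sol.hasDerivAt_wronskian hD t).continuousAt.continuousWithinAt)
      fun t ht => by
        rw [interior_Icc] at ht
        rw [(H.sol.hasDerivAt_wronskian hD t).deriv]
        have hta : t ≤ a := ht.2.le.trans hb.2
        exact mul_pos (sub_pos.2 (H.coeff_lt t ⟨ht.1.le, hta⟩))
          (mul_pos (H.pos_of_mem t ⟨ht.1, hta⟩) (hDpos t ⟨ht.1, ht.2.le⟩))
  have hlt := hW (left_mem_Icc.2 hb.1.le) (right_mem_Icc.2 hb.1.le) hb.1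
  simp only [H.zero, h0, hb0] at hlt
  have := mul_nonneg (H.deriv_nonneg b ⟨hb.1.le, hb.2⟩) (hDpos b ⟨hb.1, le_rfl⟩).le
  linarith

lemma deriv_neg_of_neumann (H : QuarterPeriod P Q V a) {S : ℝ → ℝ} (hS : IsHillSolution P S)
    (h1 : deriv S 0 = 0) {b : ℝ} (hb : b ≤ a) (hpos : ∀ t ∈ Ico 0 b, 0 < S t) :
    ∀ t ∈ Ioc 0 b, deriv S t < 0 := by
  intro t ht
  have hanti : StrictAntiOn (deriv S) (Icc 0 b) := strictAntiOn_of_deriv_neg (convex_Icc 0 b)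
    hS.2.1.continuous.continuousOn fun r hr => by
      rw [interior_Icc] at hr
      rw [(hS.hasDerivAt_deriv r).deriv, neg_lt_zero]
      exact mul_pos (H.coeff_pos r ⟨hr.1.le, hr.2.le.trans hb⟩) (hpos r ⟨hr.1.le, hr.2⟩)
  exact h1 ▸ hanti (left_mem_Icc.2 (ht.1.le.trans ht.2)) ⟨ht.1.le, ht.2⟩ ht.1

/-- A solution starting with slope `0` has no zero on the quarter period. If `b` were the first
zero of `S`, then `χ t = S (b - t)` would increase from `0` on `[0, b]`, and the Wronskian of `V`
and `χ` would be nonpositive at `b`; but its increment over `[0, b]` is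
`∫ (Q t - P (b - t)) V t χ t > ∫ (P t - P (b - t)) V t χ t ≥ 0`, the last step because `P` and
`V χ` are both nondecreasing. -/
lemma pos_of_neumann (H : QuarterPeriod P Q V a) {S : ℝ → ℝ} (hS : IsHillSolution P S)
    (h0 : 0 < S 0) (h1 : deriv S 0 = 0) : ∀ t ∈ Icc 0 a, 0 < S t := by
  intro c hc
  by_contra hcon
  obtain ⟨b, ⟨hb, hba⟩, hb0, hpos⟩ := exists_first_zero hS.1.continuous h0 hc (not_lt.1 hcon)
  have hneg := H.deriv_neg_of_neumann hS h1 hba hpos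
  have hχ := hS.const_sub b
  set χ : ℝ → ℝ := fun t => S (b - t) with hχdef
  have hχpos : ∀ t ∈ Ioc 0 b, 0 < χ t := fun t ht =>
    hpos (b - t) ⟨by linarith [ht.2], by linarith [ht.1]⟩
  have hχmono : MonotoneOn χ (Icc 0 b) := monotoneOn_of_deriv_nonneg (convex_Icc 0 b)
    hχ.1.continuous.continuousOn hχ.1.differentiableOn fun t ht => by
      rw [interior_Icc] at ht
      rw [hS.deriv_const_sub]
      exact neg_nonneg.2 (hneg (b - t) ⟨by linarith [ht.2], by linarith [ht.1]⟩).le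
  have hVmono : MonotoneOn V (Icc 0 b) := monotoneOn_of_deriv_nonneg (convex_Icc 0 b)
    H.sol.1.continuous.continuousOn H.sol.1.differentiableOn fun t ht => by
      rw [interior_Icc] at ht
      exact H.deriv_nonneg t ⟨ht.1.le, ht.2.le.trans hba⟩
  -- The integral is folded at `b / 2`: `W (b - t) - W t` is strictly decreasing on `[0, b / 2]`.
  set W : ℝ → ℝ := fun t => V t * deriv χ t - deriv V t * χ t with hWdef
  have hWd : ∀ t, HasDerivAt W ((Q t - P (b - t)) * (V t * χ t)) t :=
    fun t => H.sol.hasDerivAt_wronskian hχ t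
  have hGd : ∀ t, HasDerivAt (fun t => W (b - t) - W t)
      (-((Q (b - t) - P t) * (V (b - t) * χ (b - t))) - (Q t - P (b - t)) * (V t * χ t)) t := by
    intro t
    have h2 := ((hWd (b - t)).comp t ((hasDerivAt_id t).const_sub b)).sub (hWd t)
    refine h2.congr_deriv ?_
    rw [sub_sub_cancel]
    ring
  have hG : StrictAntiOn (fun t => W (b - t) - W t) (Icc 0 (b / 2)) := by
    refine strictAntiOn_of_deriv_neg (convex_Icc _ _)
      (fun t _ => (hGd t).continuousAt.continuousWithinAt) fun t ht => ?_
    rw [interior_Icc] at ht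
    rw [(hGd t).deriv]
    have ht1 : t ∈ Ioc 0 b := ⟨ht.1, by linarith [ht.2]⟩
    have ht2 : b - t ∈ Ioc 0 b := ⟨by linarith [ht.2], by linarith [ht.1]⟩
    have hle : t ≤ b - t := by linarith [ht.2]
    have hcl : Ioc 0 b ⊆ Icc 0 b := Ioc_subset_Icc_self
    have hcl' : Ioc 0 b ⊆ Icc 0 a := hcl.trans (Icc_subset_Icc_right hba)
    have hsub : Ioc 0 b ⊆ Ioc 0 a := Ioc_subset_Ioc_right hba
    have e1 := mul_pos (H.pos_of_mem t (hsub ht1)) (hχpos t ht1)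
    have e2 := mul_le_mul (hVmono (hcl ht1) (hcl ht2) hle) (hχmono (hcl ht1) (hcl ht2) hle)
      (hχpos t ht1).le (H.pos_of_mem _ (hsub ht2)).le
    have e3 := H.coeff_mono (hcl' ht1) (hcl' ht2) hle
    have e4 := mul_pos (sub_pos.2 (H.coeff_lt t (hcl' ht1))) e1
    have e5 := mul_pos (sub_pos.2 (H.coeff_lt _ (hcl' ht2))) (e1.trans_le e2)
    have e6 := mul_nonneg (sub_nonneg.2 e3) (sub_nonneg.2 e2)
    nlinarith
  have hlt := hG (left_mem_Icc.2 (by linarith)) (right_mem_Icc.2 (by linarith))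
    (by linarith : (0 : ℝ) < b / 2)
  simp only [sub_zero, sub_half, sub_self] at hlt
  have hW0 : W 0 = 0 := by simp [hWdef, hχdef, H.zero, hb0]
  have hWb : W b ≤ 0 := by
    have h2 : deriv χ b = 0 := by rw [hS.deriv_const_sub, sub_self, h1, neg_zero]
    have h3 := mul_nonneg (H.deriv_nonneg b ⟨hb.le, hba⟩) (hχpos b ⟨hb, le_rfl⟩).le
    simp only [hWdef, h2]
    linarith
  linarith

/-- All solutions vanishing at `0` reach the line `α x = β y` in the phase plane at time `a`. If
there is no nonzero such solution, any `α, β` will do. -/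
lemma exists_dirichlet_ratio (H : QuarterPeriod P Q V a) :
    ∃ α > 0, ∃ β > 0, ∀ D, IsHillSolution P D → D 0 = 0 → α * D a = β * deriv D a := by
  by_cases hex : ∃ D, IsHillSolution P D ∧ D 0 = 0 ∧ 0 < deriv D 0
  · obtain ⟨D₁, hD₁, h0, h1⟩ := hex
    have hpos := H.deriv_pos_of_dirichlet hD₁ h0 h1
    have hmono : StrictMonoOn D₁ (Icc 0 a) := strictMonoOn_of_deriv_pos (convex_Icc 0 a)
      hD₁.1.continuous.continuousOn fun t ht => hpos t (interior_subset ht)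
    refine ⟨deriv D₁ a, hpos a (right_mem_Icc.2 H.pos.le), D₁ a,
      h0 ▸ hmono (left_mem_Icc.2 H.pos.le) (right_mem_Icc.2 H.pos.le) H.pos, fun D hD hD0 => ?_⟩
    have := hD.wronskian_eq hD₁ 0 a
    rw [h0, hD0] at this
    linarith
  · refine ⟨1, one_pos, 1, one_pos, fun D hD hD0 => ?_⟩
    have h1 : deriv D 0 = 0 := by
      by_contra hne
      rcases lt_or_gt_of_ne hne with hlt | hgt
      · exact hex ⟨_, hD.neg, by simp [hD0], by simpa using hlt⟩
      · exact hex ⟨D, hD, hD0, hgt⟩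
    simp [hD.eq_zero H.coeff_continuous hD0 h1]

/-- The counterpart of `exists_dirichlet_ratio` for solutions with slope `0` at `0`, whose value and
slope at `a` have opposite signs. -/
lemma exists_neumann_ratio (H : QuarterPeriod P Q V a) :
    ∃ α > 0, ∃ β > 0, ∀ S, IsHillSolution P S → deriv S 0 = 0 → α * S a = -(β * deriv S a) := by
  by_cases hex : ∃ S, IsHillSolution P S ∧ deriv S 0 = 0 ∧ 0 < S 0
  · obtain ⟨S₁, hS₁, h1, h0⟩ := hex
    have hpos := H.pos_of_neumann hS₁ h0 h1
    have hneg := H.deriv_neg_of_neumann hS₁ h1 le_rfl fun t ht => hpos t ⟨ht.1, ht.2.le⟩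
    refine ⟨-deriv S₁ a, neg_pos.2 (hneg a (right_mem_Ioc.2 H.pos)), S₁ a,
      hpos a (right_mem_Icc.2 H.pos.le), fun S hS hS1 => ?_⟩
    have := hS.wronskian_eq hS₁ 0 a
    rw [h1, hS1] at this
    linarith
  · refine ⟨1, one_pos, 1, one_pos, fun S hS hS1 => ?_⟩
    have h0 : S 0 = 0 := by
      by_contra hne
      rcases lt_or_gt_of_ne hne with hlt | hgt
      · exact hex ⟨_, hS.neg, by simp [hS1], by simpa using hlt⟩
      · exact hex ⟨S, hS, hS1, hgt⟩
    simp [hS.eq_zero H.coeff_continuous h0 hS1]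

/-! ### The invariant quadratic form and stability -/

/-- A positive definite quadratic form in `(ξ, ξ')` takes the same value at both ends of a period.
Splitting `ξ` into its even part `S` and its odd part `D`, this is the product of the two relations
of `exists_dirichlet_ratio` and `exists_neumann_ratio`: for `D t = ξ t - ξ (-t)` and
`S t = ξ t + ξ (-t)`, one has `D a * S a = ξ a ^ 2 - ξ (-a) ^ 2` and
`D' a * S' a = ξ' a ^ 2 - ξ' (-a) ^ 2`. -/
lemma exists_invariant_form (H : QuarterPeriod P Q V a) (heven : ∀ t, P (-t) = P t) :
    ∃ A > 0, ∃ B > 0, ∀ ξ, IsHillSolution P ξ →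
      A * ξ a ^ 2 + B * deriv ξ a ^ 2 = A * ξ (-a) ^ 2 + B * deriv ξ (-a) ^ 2 := by
  obtain ⟨α, hα, β, hβ, hD⟩ := H.exists_dirichlet_ratio
  obtain ⟨α', hα', β', hβ', hS⟩ := H.exists_neumann_ratio
  refine ⟨α * α', mul_pos hα hα', β * β', mul_pos hβ hβ', fun ξ hξ => ?_⟩
  have hr : IsHillSolution P (fun t => ξ (0 - t)) := by
    simpa [heven] using hξ.const_sub 0
  have hSd : ∀ t, deriv (fun t => ξ t + ξ (0 - t)) t = deriv ξ t - deriv ξ (-t) := fun t => by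
    rw [((hξ.hasDerivAt t).fun_add (hξ.hasDerivAt_const_sub 0 t)).deriv, zero_sub, sub_eq_add_neg]
  have hDd : ∀ t, deriv (fun t => ξ t + -ξ (0 - t)) t = deriv ξ t + deriv ξ (-t) := fun t => by
    rw [((hξ.hasDerivAt t).fun_add (hξ.hasDerivAt_const_sub 0 t).fun_neg).deriv, zero_sub, neg_neg]
  have e1 := hD _ (hξ.add hr.neg) (by simp)
  have e2 := hS _ (hξ.add hr) (by rw [hSd, neg_zero, sub_self])
  rw [hDd] at e1
  rw [hSd] at e2
  simp only [zero_sub] at e1 e2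
  linear_combination (α' * (ξ a + ξ (-a))) * e1 + (β * (deriv ξ a + deriv ξ (-a))) * e2

/-- If the coefficient is even and `2 a`-periodic, then the trivial solution is stable: the
invariant form controls solutions at the times `(2 k + 1) a`, and Grönwall's inequality does so
in between. -/
lemma stable (H : QuarterPeriod P Q V a) (heven : ∀ t, P (-t) = P t)
    (hper : Function.Periodic P (2 * a)) : TrivialSolutionStable P := by
  intro t₀ ε hε
  obtain ⟨A, hA, B, hB, hAB⟩ := H.exists_invariant_form heven
  have ha := H.pos
  have h2a : 0 < 2 * a := by linarith
  obtain ⟨K, hK⟩ : ∃ K, ∀ t, |P t| ≤ K := by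
    obtain ⟨K, hK⟩ := (isCompact_Icc (a := (0 : ℝ)) (b := 2 * a)).exists_bound_of_continuousOn
      H.coeff_continuous.continuousOn
    refine ⟨K, fun t => ?_⟩
    obtain ⟨y, hy, hyt⟩ := hper.exists_mem_Ico₀ h2a t
    rw [hyt]
    exact hK y (Ico_subset_Icc_self hy)
  have hK0 : 0 ≤ K := (abs_nonneg _).trans (hK 0)
  set E : ℝ := Real.exp ((1 + K) * |a - t₀|)
  set F : ℝ := Real.exp ((1 + K) * (2 * a)) with hF
  have hmin : 0 < min A B := lt_min hA hB
  have hmax : 0 < max A B := hA.trans_le (le_max_left _ _)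
  set C : ℝ := max A B / min A B * E * F with hC
  have hC0 : 0 < C := by positivity
  have hmain : ∀ ξ, IsHillSolution P ξ → ∀ t,
      ξ t ^ 2 + deriv ξ t ^ 2 ≤ C * (ξ t₀ ^ 2 + deriv ξ t₀ ^ 2) := by
    intro ξ hξ t
    have hinv : ∀ k : ℤ, A * ξ (a + k * (2 * a)) ^ 2 + B * deriv ξ (a + k * (2 * a)) ^ 2
        = A * ξ a ^ 2 + B * deriv ξ a ^ 2 := by
      have hstep : ∀ k : ℤ, A * ξ (a + k * (2 * a)) ^ 2 + B * deriv ξ (a + k * (2 * a)) ^ 2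
          = A * ξ (-a + k * (2 * a)) ^ 2 + B * deriv ξ (-a + k * (2 * a)) ^ 2 := fun k => by
        have hs := hξ.add_const (k * (2 * a))
        have hPk : (fun t => P (t + k * (2 * a))) = P := funext (hper.int_mul k)
        rw [hPk] at hs
        simpa only [deriv_comp_add_const] using hAB _ hs
      intro k
      induction k using Int.induction_on with
      | zero => simp
      | succ i ih =>
        rw [hstep, ← ih]
        congr 4 <;> push_cast <;> ring_nf
      | pred i ih =>
        rw [← ih, hstep (-(i : ℤ))]
        congr 4 <;> push_cast <;> ring_nf
    -- the last time of the form `a + 2 k a` before `t`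
    obtain ⟨k, hk, -⟩ := existsUnique_add_zsmul_mem_Ico h2a (-(t - a)) (-(2 * a))
    rw [zsmul_eq_mul] at hk
    set s : ℝ := a + k * (2 * a) with hs
    have e1 : ξ t ^ 2 + deriv ξ t ^ 2 ≤ (ξ s ^ 2 + deriv ξ s ^ 2) * F := by
      refine (hξ.energy_le (s := s) (by linarith [hk.2]) fun r _ => hK r).trans ?_
      rw [hF]
      gcongr
      linarith [hk.1]
    have e2 : ξ a ^ 2 + deriv ξ a ^ 2 ≤ (ξ t₀ ^ 2 + deriv ξ t₀ ^ 2) * E :=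
      hξ.energy_le_abs fun r _ => hK r
    have e3 : min A B * (ξ s ^ 2 + deriv ξ s ^ 2) ≤ A * ξ s ^ 2 + B * deriv ξ s ^ 2 := by
      rw [mul_add]
      gcongr
      · exact min_le_left _ _
      · exact min_le_right _ _
    have e4 : A * ξ a ^ 2 + B * deriv ξ a ^ 2 ≤ max A B * (ξ a ^ 2 + deriv ξ a ^ 2) := by
      rw [mul_add]
      gcongr
      · exact le_max_left _ _
      · exact le_max_right _ _
    have e5 : ξ s ^ 2 + deriv ξ s ^ 2 ≤ max A B / min A B * (ξ a ^ 2 + deriv ξ a ^ 2) := by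
      rw [div_mul_eq_mul_div, le_div_iff₀' hmin]
      linarith [hinv k]
    calc ξ t ^ 2 + deriv ξ t ^ 2 ≤ (ξ s ^ 2 + deriv ξ s ^ 2) * F := e1
      _ ≤ max A B / min A B * ((ξ t₀ ^ 2 + deriv ξ t₀ ^ 2) * E) * F := by
        gcongr
        exact e5.trans (by gcongr)
      _ = C * (ξ t₀ ^ 2 + deriv ξ t₀ ^ 2) := by
        rw [hC]
        ring
  refine ⟨ε / (2 * (1 + C)), by positivity, fun ξ hξ h0 h1 t => ?_⟩
  have hb := hmain ξ hξ t
  have h2 : ξ t₀ ^ 2 ≤ (ε / (2 * (1 + C))) ^ 2 := by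
    rw [← sq_abs]
    gcongr
  have h3 : deriv ξ t₀ ^ 2 ≤ (ε / (2 * (1 + C))) ^ 2 := by
    rw [← sq_abs]
    gcongr
  have h4 : C * (ξ t₀ ^ 2 + deriv ξ t₀ ^ 2) < ε ^ 2 := by
    have h5 : C * (ξ t₀ ^ 2 + deriv ξ t₀ ^ 2) ≤ C * (2 * (ε / (2 * (1 + C))) ^ 2) :=
      mul_le_mul_of_nonneg_left (by linarith) hC0.le
    refine h5.trans_lt ?_
    rw [div_pow, ← sub_pos]
    have : ε ^ 2 - C * (2 * (ε ^ 2 / (2 * (1 + C)) ^ 2))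
        = ε ^ 2 * (2 + 3 * C + 2 * C ^ 2) / (2 * (1 + C) ^ 2) := by
      field_simp
      ring
    rw [this]
    positivity
  exact ⟨abs_lt_of_sq_lt_sq (by nlinarith [sq_nonneg (deriv ξ t)]) hε.le,
    abs_lt_of_sq_lt_sq (by nlinarith [sq_nonneg (ξ t)]) hε.le⟩

end QuarterPeriod

lemma TrivialSolutionStable.of_const_sub {p : ℝ → ℝ} {c : ℝ}
    (h : TrivialSolutionStable (fun t => p (c - t))) : TrivialSolutionStable p := by
  intro t₀ ε hε
  obtain ⟨ρ, hρ, hs⟩ := h (c - t₀) ε hε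
  refine ⟨ρ, hρ, fun ξ hξ h0 h1 t => ?_⟩
  have := hs _ (hξ.const_sub c) (by simpa using h0) (by simpa [hξ.deriv_const_sub] using h1) (c - t)
  simpa [hξ.deriv_const_sub] using this

/-! ### The mode -/

/-- A nonlinear mode solves Duffing's equation, here read as a Hill equation for the mode. -/
lemma IsNonlinearMode.isHillSolution {m : ℕ} (hm : 1 ≤ m) {Θ : ℝ → ℝ} (h : IsNonlinearMode m Θ) :
    IsHillSolution (fun t => (m : ℝ) ^ 4 + (m : ℝ) ^ 4 * Θ t ^ 2) Θ := by
  have hm1 : (1 : ℝ) ≤ m := by exact_mod_cast hm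
  have hm0 : (m : ℝ) ≠ 0 := by positivity
  -- the antinode `π / (2 m)`, where `sin (m x) = 1`
  set x₀ : ℝ := Real.pi / (2 * m) with hx₀
  have hx : x₀ ∈ Ioo 0 Real.pi := ⟨by positivity, by
    rw [hx₀, div_lt_iff₀ (by positivity)]
    nlinarith [Real.pi_pos]⟩
  have hmx : (m : ℝ) * x₀ = Real.pi / 2 := by
    rw [hx₀]
    field_simp
  have hsm : ContDiff ℝ 2 Θ := by simpa [hmx] using h.contDiff_time x₀ (Ioo_subset_Icc_self hx)
  have hd1 : Differentiable ℝ Θ := hsm.differentiable (by norm_num)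
  have hd2 : Differentiable ℝ (deriv Θ) := by
    have : ContDiff ℝ (1 + 1) Θ := by simpa [one_add_one_eq_two] using hsm
    exact (contDiff_succ_iff_deriv.1 this).2.2.differentiable one_ne_zero
  refine ⟨hd1, hd2, fun t => ?_⟩
  have heq := h.equation x₀ hx t
  have hdsin : ∀ c : ℝ, deriv (fun y => c * Real.sin (m * y)) = fun y => c * m * Real.cos (m * y) :=
    fun c => funext fun y => by
      have := (((hasDerivAt_id y).const_mul (m : ℝ)).sin.const_mul c).deriv
      simp only [id, mul_one] at this
      rw [this]
      ring
  have hdcos : ∀ c : ℝ,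
      deriv (fun y => c * Real.cos (m * y)) = fun y => -(c * m) * Real.sin (m * y) :=
    fun c => funext fun y => by
      have := (((hasDerivAt_id y).const_mul (m : ℝ)).cos.const_mul c).deriv
      simp only [id, mul_one] at this
      rw [this]
      ring
  have hcd : ∀ k : ℕ, ContDiff ℝ k (fun y => Θ t * Real.sin (m * y)) := fun k => by fun_prop
  have hu : UniqueDiffOn ℝ (Icc 0 Real.pi) := uniqueDiffOn_Icc Real.pi_pos
  have hint : ∫ y in (0 : ℝ)..Real.pi,
      (derivWithin (fun z => Θ t * Real.sin (m * z)) (Icc 0 Real.pi) y) ^ 2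
      = Θ t ^ 2 * m ^ 2 * (Real.pi / 2) := by
    have h1 : ∀ y ∈ uIcc 0 Real.pi,
        (derivWithin (fun z => Θ t * Real.sin (m * z)) (Icc 0 Real.pi) y) ^ 2
        = Θ t ^ 2 * m ^ 2 * Real.cos (m * y) ^ 2 := fun y hy => by
      rw [uIcc_of_le Real.pi_pos.le] at hy
      rw [((hcd 1).differentiable (by norm_num) y).derivWithin (hu y hy), hdsin]
      ring
    rw [intervalIntegral.integral_congr h1, intervalIntegral.integral_const_mul,
      intervalIntegral.integral_comp_mul_left (fun y => Real.cos y ^ 2) hm0, integral_cos_sq]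
    simp only [mul_zero, Real.sin_nat_mul_pi, Real.sin_zero, smul_eq_mul, sub_zero, zero_add]
    field_simp
  have h4 := iteratedDerivWithin_eq_iteratedDeriv hu (hcd 4).contDiffAt (Ioo_subset_Icc_self hx)
  have h2 := iteratedDerivWithin_eq_iteratedDeriv hu (hcd 2).contDiffAt (Ioo_subset_Icc_self hx)
  norm_cast at heq h4 h2
  rw [hint, h4, h2] at heq
  simp only [iteratedDeriv_succ', iteratedDeriv_zero, hdsin, hdcos, hmx, Real.sin_pi_div_two,
    mul_one] at heq
  field_simp at heq
  linarith

/-- The difference of two solutions of Duffing's equation solves a Hill equation, so that solutions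
with the same data at `0` agree. -/
lemma duffing_unique {μ : ℝ} {u v : ℝ → ℝ} (hu : IsHillSolution (fun t => μ + μ * u t ^ 2) u)
    (hv : IsHillSolution (fun t => μ + μ * v t ^ 2) v) (h0 : u 0 = v 0)
    (h1 : deriv u 0 = deriv v 0) : u = v := by
  have hd : ∀ t, HasDerivAt (fun t => u t - v t) (deriv u t - deriv v t) t :=
    fun t => (hu.hasDerivAt t).sub (hv.hasDerivAt t)
  have hw : IsHillSolution (fun t => μ + μ * (u t ^ 2 + u t * v t + v t ^ 2))
      (fun t => u t - v t) :=
    .of_hasDerivAt hd fun t =>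
      ((hu.hasDerivAt_deriv t).sub (hv.hasDerivAt_deriv t)).congr_deriv (by ring)
  have hcu := hu.1.continuous
  have hcv := hv.1.continuous
  have := hw.eq_zero (by fun_prop) (by simp [h0]) (by rw [(hd 0).deriv, h1, sub_self])
  exact funext fun t => sub_eq_zero.1 (congrFun this t)

/-- A solution of Duffing's equation released from rest at a positive height reaches `0`: as long
as it is positive it is concave, with negative slope. -/
lemma exists_duffing_zero {μ δ : ℝ} (hμ : 0 < μ) (hδ : 0 < δ) {Θ : ℝ → ℝ}
    (h : IsHillSolution (fun t => μ + μ * Θ t ^ 2) Θ) (h0 : Θ 0 = δ) (h1 : deriv Θ 0 = 0) :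
    ∃ a > 0, Θ a = 0 ∧ (∀ t ∈ Ico 0 a, 0 < Θ t) ∧ ∀ t ∈ Icc 0 a, deriv Θ t ≤ 0 := by
  have hanti : ∀ b, (∀ t ∈ Ico 0 b, 0 < Θ t) → StrictAntiOn (deriv Θ) (Icc 0 b) := fun b hb =>
    strictAntiOn_of_deriv_neg (convex_Icc 0 b) h.2.1.continuous.continuousOn fun t ht => by
      rw [interior_Icc] at ht
      have := hb t ⟨ht.1.le, ht.2⟩
      rw [(h.hasDerivAt_deriv t).deriv]
      have : 0 < (μ + μ * Θ t ^ 2) * Θ t := by positivity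
      linarith
  obtain ⟨c, hc, hcΘ⟩ : ∃ c, 0 ≤ c ∧ Θ c ≤ 0 := by
    by_contra! hcon
    have hlt : ∀ t, 0 < t → deriv Θ t < 0 := fun t ht => h1 ▸
      hanti t (fun r hr => hcon r hr.1) (left_mem_Icc.2 ht.le) (right_mem_Icc.2 ht.le) ht
    -- past time `1`, `Θ` stays below its tangent line at `1`
    set T : ℝ := 1 + Θ 1 / (-deriv Θ 1) with hT
    have hs := hlt 1 one_pos
    have hs' : 0 < -deriv Θ 1 := neg_pos.2 hs
    have hT1 : 1 < T := by
      have := div_pos (hcon 1 zero_le_one) hs'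
      linarith
    obtain ⟨r, hr, hre⟩ := exists_deriv_eq_slope Θ hT1 h.1.continuous.continuousOn
      h.1.differentiableOn
    have hr1 : deriv Θ r ≤ deriv Θ 1 :=
      (hanti r (fun r hr => hcon r hr.1) ⟨zero_le_one, hr.1.le⟩
        ⟨by linarith [hr.1], le_rfl⟩ hr.1).le
    rw [hre, div_le_iff₀ (by linarith)] at hr1
    have hTe : deriv Θ 1 * (T - 1) = -Θ 1 := by
      have hs0 : deriv Θ 1 ≠ 0 := hs.ne
      rw [hT]
      field_simp
      ring
    linarith [hcon T (by linarith)]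
  obtain ⟨a, ha, ha0, hpos⟩ := exists_first_zero h.1.continuous (h0 ▸ hδ)
    (show c ∈ Icc 0 c from ⟨hc, le_rfl⟩) hcΘ
  refine ⟨a, ha.1, ha0, hpos, fun t ht => ?_⟩
  exact h1 ▸ (hanti a hpos).antitoneOn (left_mem_Icc.2 ha.1.le) ht ht.1

lemma linearlyStable_of_pos {m n : ℕ} (hn : 1 ≤ n) (hmn : n < m) {δ : ℝ} (hδ : 0 < δ) {Θ : ℝ → ℝ}
    (h : IsHillSolution (fun t => (m : ℝ) ^ 4 + (m : ℝ) ^ 4 * Θ t ^ 2) Θ)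
    (h0 : Θ 0 = δ) (h1 : deriv Θ 0 = 0) : LinearlyStable m n Θ := by
  have hn0 : (0 : ℝ) < n := by exact_mod_cast hn
  have hnm : (n : ℝ) < m := by exact_mod_cast hmn
  have hm0 : (0 : ℝ) < m := hn0.trans hnm
  obtain ⟨a, ha, ha0, hpos, hder⟩ := exists_duffing_zero (pow_pos hm0 4) hδ h h0 h1
  have heven : ∀ t, Θ (-t) = Θ t := by
    have h2 := h.const_sub 0
    have := duffing_unique h2 h (by simp) (by rw [h.deriv_const_sub]; simp [h1])
    exact fun t => by simpa using congrFun this t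
  obtain ⟨V, hVdef⟩ : ∃ V : ℝ → ℝ, V = fun t => Θ (a - t) := ⟨_, rfl⟩
  have hV : IsHillSolution (fun t => (m : ℝ) ^ 4 + (m : ℝ) ^ 4 * V t ^ 2) V := by
    rw [hVdef]
    exact h.const_sub a
  have hVd : ∀ t, deriv V t = -deriv Θ (a - t) := by
    rw [hVdef]
    exact h.deriv_const_sub a
  have hV0 : V 0 = 0 := by simp [hVdef, ha0]
  have hodd : ∀ t, V (-t) = -V t := by
    have h2 : IsHillSolution (fun t => (m : ℝ) ^ 4 + (m : ℝ) ^ 4 * (-V (0 - t)) ^ 2)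
        (fun t => -V (0 - t)) := by
      simpa using (hV.const_sub 0).neg
    have := duffing_unique h2 hV (by simp [hV0]) (by
      rw [((hV.hasDerivAt_const_sub 0 0).fun_neg).deriv]
      simp)
    exact fun t => by simpa using congrArg Neg.neg (congrFun this t)
  have hanti : ∀ t, V (t + 2 * a) = -V t := fun t => by
    have e1 : V (t + 2 * a) = V (-t) := by
      simp only [hVdef]
      rw [← heven]
      ring_nf
    rw [e1, hodd]
  have hmono : MonotoneOn V (Icc 0 a) := monotoneOn_of_deriv_nonneg (convex_Icc 0 a)
    hV.1.continuous.continuousOn hV.1.differentiableOn fun t ht => by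
      rw [interior_Icc] at ht
      rw [hVd]
      exact neg_nonneg.2 (hder _ ⟨by linarith [ht.2], by linarith [ht.1]⟩)
  have hVpos : ∀ t ∈ Ioc 0 a, 0 < V t := fun t ht =>
    by
    rw [hVdef]
    exact hpos _ ⟨by linarith [ht.2], by linarith [ht.1]⟩
  have hVc := hV.1.continuous
  have H : QuarterPeriod (fun t => (n : ℝ) ^ 4 + (m : ℝ) ^ 2 * (n : ℝ) ^ 2 * V t ^ 2)
      (fun t => (m : ℝ) ^ 4 + (m : ℝ) ^ 4 * V t ^ 2) V a :=
    { pos := ha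
      sol := hV
      zero := hV0
      pos_of_mem := hVpos
      deriv_nonneg := fun t ht => by
        rw [hVd]
        exact neg_nonneg.2 (hder _ ⟨by linarith [ht.2], by linarith [ht.1]⟩)
      coeff_continuous := by fun_prop
      coeff_pos := fun t _ => by positivity
      coeff_mono := fun s hs t ht hst => by
        have := hmono hs ht hst
        have h3 : 0 ≤ V s := hV0 ▸ hmono (left_mem_Icc.2 ha.le) hs hs.1
        change _ + _ ≤ _ + _
        gcongr
      coeff_lt := fun t _ => by
        have e1 : (n : ℝ) ^ 4 < (m : ℝ) ^ 4 := by gcongr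
        have e2 : (m : ℝ) ^ 2 * (n : ℝ) ^ 2 * V t ^ 2 ≤ (m : ℝ) ^ 2 * (m : ℝ) ^ 2 * V t ^ 2 := by
          gcongr
        have e3 : (m : ℝ) ^ 2 * (m : ℝ) ^ 2 * V t ^ 2 = (m : ℝ) ^ 4 * V t ^ 2 := by ring
        linarith }
  have hst := H.stable (fun t => by simp [hodd]) fun t => by simp [hanti]
  rw [hVdef] at hst
  exact TrivialSolutionStable.of_const_sub hst

theorem theorem4p2 (m n : ℕ) (hn : 1 ≤ n) (hmn : n < m) (δ : ℝ) (hδ : δ ≠ 0)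
    (Θ : ℝ → ℝ) (hΘ : IsNonlinearMode m Θ) (h0 : Θ 0 = δ) (h1 : deriv Θ 0 = 0) :
    LinearlyStable m n Θ := by
  have h := hΘ.isHillSolution (hn.trans hmn.le)
  rcases lt_or_gt_of_ne hδ with hneg | hpos
  · -- `-Θ` is a mode as well, and the Hill equation sees only `Θ ^ 2`
    have := linearlyStable_of_pos hn hmn (neg_pos.2 hneg) (Θ := fun t => -Θ t)
      (by simpa using h.neg) (by simp [h0]) (by simp [h1])
    simpa [LinearlyStable] using this
  · exact linearlyStable_of_pos hn hmn hpos h h0 h1
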